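/- For non-negative integers $n,k,s$ let $V(n,k,s)$ be the set of all $k$-element subsets $S$ of $[n]=\{1,\ldots,n\}$ such that $|i-j|\ge s$ for all distinct $i,j\in S$. The almost $s$-stable Kneser hypergraph $KG^r\binom{[n]}{k}^{\sim}_{s\text{-stab}}$ is the $r$-uniform hypergraph with vertex set $V(n,k,s)$ whose edges are the sets of $r$ pairwise disjoint elements of $V(n,k,s)$. The chromatic number $\chi(\mathcal H)$ of a hypergraph $\mathcal H$ is the least $t$ for which its vertices can be colored with $t$ colors so that every edge contains two vertices of different colors. Let $\mu(r)$ be the number of prime divisors of $r$ counted with multiplicity. Let $n,k,r$ be integers with $r\ge 2$, $k\ge 1$ and $n\ge rk$. Then $$\chi\left(KG^r\binom{[n]}{k}^{\sim}_{2^{\mu(r)}\text{-stab}}\right)=\left\lceil\frac{n-(k-1)r}{r-1}\right\rceil .$$ -/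

import Mathlib

/-- A proper coloring of the hypergraph `H` with `t` colors: a map `c` from the vertex set to a set
of `t` colors such that every edge contains two vertices of different colors. -/
def Hypergraph.IsProperColoring {α : Type*} (H : Hypergraph α) {t : ℕ}
    (c : H.vertexSet → Fin t) : Prop :=
  ∀ e ∈ H.edgeSet, ∃ x y : H.vertexSet, (x : α) ∈ e ∧ (y : α) ∈ e ∧ c x ≠ c y

/-- The chromatic number of `H`: the least `t` such that `H` has a proper coloring with `t` colors
(`⊤` if there is no such `t`). -/
noncomputable def Hypergraph.chromaticNumber {α : Type*} (H : Hypergraph α) : ℕ∞ :=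
  ⨅ t ∈ {t : ℕ | ∃ c : H.vertexSet → Fin t, H.IsProperColoring c}, (t : ℕ∞)

/-- `V(n,k,s)`: the `k`-element subsets `S` of `[n] = {1, …, n}` such that `|i - j| ≥ s` for all
distinct `i, j ∈ S`. -/
def almostStableSets (n k s : ℕ) : Set (Finset ℕ) :=
  {S | S ⊆ Finset.Icc 1 n ∧ S.card = k ∧
    ∀ i ∈ S, ∀ j ∈ S, i ≠ j → (s : ℤ) ≤ |(i : ℤ) - (j : ℤ)|}

/-- The almost `s`-stable Kneser hypergraph: the vertices are the elements of `V(n,k,s)`, the edges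
are the sets of `r` pairwise disjoint elements of `V(n,k,s)`. -/
def almostStableKneser (r n k s : ℕ) : Hypergraph (Finset ℕ) where
  vertexSet := almostStableSets n k s
  edgeSet := {e | e ⊆ almostStableSets n k s ∧ e.encard = (r : ℕ∞) ∧
    ∀ S ∈ e, ∀ T ∈ e, S ≠ T → Disjoint S T}
  subset_vertexSet_of_mem_edgeSet' := fun _ he => he.1

/-! For `t ≥ 1`, proper colorings with `t` colors exist exactly when `n ≤ (r - 1) t + (k - 1) r`;
solving for `t` gives the ceiling.

If the inequality holds, color a set by the block of `r - 1` consecutive integers containing its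
minimum, the last block running up to `n`. Disjoint sets have distinct minima, so `r` of them cannot
share an early block, and the last block is too short to hold `r` disjoint `k`-sets
(`exists_isProperColoring`).

Otherwise `r` disjoint sets of one color are forced. This property is multiplicative in `r` and in
the gap (`ForcesMonochromatic.mul`), so a prime `p` with gap 2 is enough. There a coloring without
`p` disjoint monochromatic sets gives a labeling that violates the `ZMod p`-Tucker lemma
(`le_of_equivariant_labeling`). A signed list with at most `p (k - 1)` sign blocks is labeled by its
number of blocks. One with more blocks contains a 2-stable `k`-set of a single sign, and is labeled
by the number of pairs (color, sign) that it realizes.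

The Tucker lemma is proved with chains mod `p`. The labeling induces an equivariant chain map;
explicit chains in the join are detected, in each dimension below `n`, by cochains taking the value
1 on an operator applied to their images. If `N < n`, the top image is 0, a contradiction. -/

namespace ListChain

open Finsupp

variable {R : Type*} [CommRing R] {α β γ : Type*}

/-! ### Augmented chains on lists: cones, boundary, induced maps. -/

/-- A linear map sends chains supported on `S` into any submodule containing the images of the
lists in `S`. -/
theorem map_mem_of_mem_supported {M : Type*} [AddCommGroup M] [Module R M] {S : Set α}
    (F : (α →₀ R) →ₗ[R] M) (Q : Submodule R M) (h : ∀ l ∈ S, F (single l 1) ∈ Q)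
    {c : α →₀ R} (hc : c ∈ supported R R S) : F c ∈ Q := by
  have : supported R R S ≤ Q.comap F := by
    rw [supported_eq_span_single, Submodule.span_le]
    rintro _ ⟨l, hl, rfl⟩
    exact h l hl
  exact this hc

theorem eq_of_mem_supported {M : Type*} [AddCommGroup M] [Module R M] {S : Set α}
    (F F' : (α →₀ R) →ₗ[R] M) (h : ∀ l ∈ S, F (single l 1) = F' (single l 1))
    {c : α →₀ R} (hc : c ∈ supported R R S) : F c = F' c := by
  simpa [sub_eq_zero] using
    map_mem_of_mem_supported (F - F') ⊥ (fun l hl => by simp [h l hl]) hc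

/-- The cone over a chain with apex `v`. -/
noncomputable def cone (v : α) : (List α →₀ R) →ₗ[R] (List α →₀ R) :=
  lmapDomain R R (List.cons v)

@[simp] theorem cone_single (v : α) (l : List α) (a : R) :
    cone v (single l a) = single (v :: l) a := by
  simp [cone]

/-- The alternating sum of the codimension-one faces of a list. -/
noncomputable def faces : List α → (List α →₀ R)
  | [] => 0
  | v :: l => single l 1 - cone v (faces l)

/-- The boundary of a chain of lists. -/
noncomputable def boundary : (List α →₀ R) →ₗ[R] (List α →₀ R) :=
  linearCombination R faces

@[simp] theorem boundary_single (l : List α) :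
    boundary (single l (1 : R)) = faces l := by
  simp [boundary]

theorem boundary_cone (v : α) (c : List α →₀ R) :
    boundary (cone v c) = c - cone v (boundary c) := by
  have : boundary ∘ₗ cone v = LinearMap.id - cone (R := R) v ∘ₗ boundary := by
    ext1 l
    ext1
    simp [faces]
  exact LinearMap.congr_fun this c

theorem boundary_faces (l : List α) : boundary (faces l : List α →₀ R) = 0 := by
  induction l with
  | nil => simp [faces]
  | cons v l ih => simp [faces, boundary_cone, ih]

theorem faces_mem_supported (l : List α) :
    (faces l : List α →₀ R) ∈
      supported R R {l' : List α | l'.Sublist l ∧ l'.length + 1 = l.length} := by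
  induction l with
  | nil => simp [faces]
  | cons v l ih =>
    refine Submodule.sub_mem _ (single_mem_supported R 1 (by simp)) ?_
    refine map_mem_of_mem_supported (R := R) (cone v) _ (fun m hm => ?_) ih
    rw [cone_single]
    exact single_mem_supported R 1 ⟨hm.1.cons_cons v, by simp [hm.2]⟩

/-- The chain map induced by a map of vertices. -/
noncomputable def push (f : α → β) : (List α →₀ R) →ₗ[R] (List β →₀ R) :=
  lmapDomain R R (List.map f)

@[simp] theorem push_single (f : α → β) (l : List α) (a : R) :
    push f (single l a) = single (l.map f) a := by
  simp [push]

theorem push_cone (f : α → β) (v : α) (c : List α →₀ R) :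
    push f (cone v c) = cone (f v) (push f c) := by
  have : push f ∘ₗ cone v = cone (R := R) (f v) ∘ₗ push f := by
    ext1 l
    ext1
    simp
  exact LinearMap.congr_fun this c

theorem push_faces (f : α → β) (l : List α) :
    push f (faces l : List α →₀ R) = faces (l.map f) := by
  induction l with
  | nil => simp [faces]
  | cons v l ih => simp [faces, push_cone, ih]

theorem boundary_push (f : α → β) (c : List α →₀ R) :
    boundary (push f c) = push f (boundary c) := by
  have : boundary ∘ₗ push f = push (R := R) f ∘ₗ boundary := by
    ext1 l
    ext1
    simp [push_faces]
  exact LinearMap.congr_fun this c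

/-! ### Joins with a vertex, and the chain map of a labeling. -/

/-- Signed insertion of the vertex `v` into a list of vertices sorted by level. -/
noncomputable def insertList (v : ℕ × γ) : List (ℕ × γ) → (List (ℕ × γ) →₀ R)
  | [] => single [v] 1
  | w :: l =>
    if v.1 < w.1 then single (v :: w :: l) 1
    else if v.1 = w.1 then 0 else - cone w (insertList v l)

/-- The join of a vertex with a chain of lists sorted by level. -/
noncomputable def join (v : ℕ × γ) : (List (ℕ × γ) →₀ R) →ₗ[R] (List (ℕ × γ) →₀ R) :=
  linearCombination R (insertList v)

@[simp] theorem join_single (v : ℕ × γ) (l : List (ℕ × γ)) :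
    join v (single l (1 : R)) = insertList v l := by
  simp [join]

theorem insertList_of_lt (v : ℕ × γ) (l : List (ℕ × γ)) (h : ∀ w ∈ l, v.1 < w.1) :
    (insertList v l : List (ℕ × γ) →₀ R) = single (v :: l) 1 := by
  cases l with
  | nil => rfl
  | cons w l => simp [insertList, h w (by simp)]

theorem insertList_mem_supported (v : ℕ × γ) (l : List (ℕ × γ))
    (hl : l.Pairwise (fun a b => a.1 < b.1)) :
    (insertList v l : List (ℕ × γ) →₀ R) ∈ supported R R
      {m | m.Pairwise (fun a b => a.1 < b.1) ∧ m.length = l.length + 1 ∧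
        ∀ w ∈ m, w = v ∨ w ∈ l} := by
  induction l with
  | nil => exact single_mem_supported R 1 (by simp)
  | cons w l ih =>
    rw [List.pairwise_cons] at hl
    rw [insertList]
    split_ifs with h1 h2
    · refine single_mem_supported R 1 ⟨?_, by simp, by simp⟩
      simp only [List.pairwise_cons, List.mem_cons, forall_eq_or_imp]
      exact ⟨⟨h1, fun a ha => h1.trans (hl.1 a ha)⟩, hl.1, hl.2⟩
    · exact Submodule.zero_mem _
    · refine Submodule.neg_mem _ (map_mem_of_mem_supported (R := R) (cone w) _
        (fun m hm => ?_) (ih hl.2))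
      rw [cone_single]
      refine single_mem_supported R 1 ⟨?_, by simp [hm.2.1], ?_⟩
      · refine List.pairwise_cons.2 ⟨fun a ha => ?_, hm.1⟩
        rcases hm.2.2 a ha with rfl | h
        · omega
        · exact hl.1 a h
      · intro a ha
        rcases List.mem_cons.1 ha with rfl | ha
        · simp
        · rcases hm.2.2 a ha with rfl | h <;> simp [*]

theorem join_cone_of_lt (v w : ℕ × γ) (h : w.1 < v.1) (c : List (ℕ × γ) →₀ R) :
    join v (cone w c) = - cone w (join v c) := by
  have : join v ∘ₗ cone w = - (cone (R := R) w ∘ₗ join v) := by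
    ext1 l
    ext1
    simp [insertList, h.ne', h.not_gt]
  exact LinearMap.congr_fun this c

/-- The Leibniz rule for a join. When the level of `v` already occurs in `l`, `hv` makes the
repeated vertex equal to `v`; the join is then degenerate, and the value 0 chosen for it is
consistent with the rule. -/
theorem boundary_insertList (v : ℕ × γ) (l : List (ℕ × γ))
    (hl : l.Pairwise (fun a b => a.1 < b.1)) (hv : ∀ w ∈ l, w.1 = v.1 → w = v) :
    boundary (insertList v l : List (ℕ × γ) →₀ R) = single l 1 - join v (faces l) := by
  induction l with
  | nil => simp [insertList, faces]
  | cons w l ih =>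
    rw [List.pairwise_cons] at hl
    rcases lt_trichotomy v.1 w.1 with h | h | h
    · have hlt : ∀ a ∈ w :: l, v.1 < a.1 := by
        intro a ha
        rcases List.mem_cons.1 ha with rfl | ha
        · exact h
        · exact h.trans (hl.1 a ha)
      rw [insertList_of_lt v _ hlt, boundary_single, faces]
      congr 1
      refine eq_of_mem_supported (R := R) (cone v) (join v) (fun m hm => ?_)
        (faces_mem_supported (w :: l))
      rw [cone_single, join_single, insertList_of_lt]
      exact fun a ha => hlt a (hm.1.subset ha)
    · have hw : w = v := hv w (by simp) h.symm
      subst hw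
      have h2 : join w (cone w (faces l)) = (0 : List (ℕ × γ) →₀ R) := by
        have : join w ∘ₗ cone w = (0 : (List (ℕ × γ) →₀ R) →ₗ[R] _) := by
          ext1 l
          ext1
          simp [insertList]
        exact LinearMap.congr_fun this _
      rw [faces, map_sub, h2, join_single, insertList_of_lt w l hl.1]
      simp [insertList]
    · rw [insertList, if_neg (by omega), if_neg (by omega), map_neg, boundary_cone,
        ih hl.2 (fun a ha => hv a (by simp [ha])), faces, map_sub, map_sub,
        join_cone_of_lt v w h, join_single, cone_single]
      abel

theorem push_insertList (f : γ → γ) (v : ℕ × γ) (l : List (ℕ × γ)) :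
    push (Prod.map id f) (insertList v l : List (ℕ × γ) →₀ R) =
      insertList (Prod.map id f v) (l.map (Prod.map id f)) := by
  induction l with
  | nil => simp [insertList]
  | cons w l ih =>
    simp only [insertList, List.map_cons, Prod.map_fst, id]
    split_ifs
    · simp
    · simp
    · simp [push_cone, ih]

theorem push_join (f : γ → γ) (v : ℕ × γ) (c : List (ℕ × γ) →₀ R) :
    push (Prod.map id f) (join v c) = join (Prod.map id f v) (push (Prod.map id f) c) := by
  have : push (Prod.map id f) ∘ₗ join v =
      join (R := R) (Prod.map id f v) ∘ₗ push (Prod.map id f) := by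
    ext1 l
    ext1
    simp [push_insertList]
  exact LinearMap.congr_fun this c

/-- The composite of barycentric subdivision with the simplicial map given by the labeling `lab`
of faces, on a list of length `d`. -/
noncomputable def subdivideList (lab : List (ℕ × γ) → ℕ × γ) :
    ℕ → List (ℕ × γ) → (List (ℕ × γ) →₀ R)
  | 0, _ => single [] 1
  | d + 1, l => join (lab l) (linearCombination R (subdivideList lab d) (faces l))

/-- The linear extension of `subdivideList`. -/
noncomputable def subdivide (lab : List (ℕ × γ) → ℕ × γ) (d : ℕ) :
    (List (ℕ × γ) →₀ R) →ₗ[R] (List (ℕ × γ) →₀ R) :=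
  linearCombination R (subdivideList lab d)

@[simp] theorem subdivide_single (lab : List (ℕ × γ) → ℕ × γ) (d : ℕ) (l : List (ℕ × γ)) :
    subdivide lab d (single l (1 : R)) = subdivideList lab d l := by
  simp [subdivide]

theorem subdivideList_succ (lab : List (ℕ × γ) → ℕ × γ) (d : ℕ) (l : List (ℕ × γ)) :
    (subdivideList lab (d + 1) l : List (ℕ × γ) →₀ R) =
      join (lab l) (subdivide lab d (faces l)) := rfl

/-- Images have as many distinct levels as the source has vertices, all of them levels of labels of
faces. This makes the top image vanish when there are too few levels. -/
theorem subdivideList_mem_supported (lab : List (ℕ × γ) → ℕ × γ) (d : ℕ) (l : List (ℕ × γ))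
    (hl : l.length = d) :
    (subdivideList lab d l : List (ℕ × γ) →₀ R) ∈ supported R R
      {m | m.Pairwise (fun a b => a.1 < b.1) ∧ m.length = d ∧
        ∀ w ∈ m, ∃ l', l'.Sublist l ∧ l' ≠ [] ∧ lab l' = w} := by
  induction d generalizing l with
  | zero => exact single_mem_supported R 1 (by simp)
  | succ d ih =>
    rw [subdivideList_succ]
    refine map_mem_of_mem_supported (R := R) (join (lab l) ∘ₗ subdivide lab d) _ (fun l' hl' => ?_)
      (faces_mem_supported l)
    rw [LinearMap.comp_apply, subdivide_single]
    refine map_mem_of_mem_supported (R := R) (join (lab l)) _ (fun m hm => ?_)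
      (ih l' (by have := hl'.2; omega))
    rw [join_single]
    refine supported_mono ?_ (insertList_mem_supported (lab l) m hm.1)
    rintro m' ⟨h1, h2, h3⟩
    refine ⟨h1, by rw [h2, hm.2.1], fun w hw => ?_⟩
    rcases h3 w hw with rfl | h
    · exact ⟨l, List.Sublist.refl l, by rintro rfl; simp at hl, rfl⟩
    · obtain ⟨l'', h4, h5⟩ := hm.2.2 w h
      exact ⟨l'', h4.trans hl'.1, h5⟩

/-- The labeling induces a chain map. The new vertex `lab l` is joined to labels of proper faces of
`l`, so `hlab` supplies the compatibility that `boundary_insertList` needs. -/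
theorem boundary_subdivideList {lab : List (ℕ × γ) → ℕ × γ} {S : Set (List (ℕ × γ))}
    (hS : ∀ l ∈ S, ∀ l', l'.Sublist l → l' ∈ S)
    (hlab : ∀ l ∈ S, ∀ l', l'.Sublist l → l' ≠ [] → (lab l').1 = (lab l).1 → lab l' = lab l)
    (d : ℕ) (l : List (ℕ × γ)) (hlS : l ∈ S) (hl : l.length = d + 1) :
    boundary (subdivideList lab (d + 1) l : List (ℕ × γ) →₀ R) =
      subdivide lab d (faces l) := by
  induction d generalizing l with
  | zero =>
    obtain ⟨v, rfl⟩ := List.length_eq_one_iff.1 hl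
    simp [subdivideList, faces, insertList, subdivide]
  | succ d ih =>
    have hsupp : (subdivide lab (d + 1) (faces l) : List (ℕ × γ) →₀ R) ∈ supported R R
        {m | m.Pairwise (fun a b => a.1 < b.1) ∧ ∀ w ∈ m, w.1 = (lab l).1 → w = lab l} := by
      refine map_mem_of_mem_supported (R := R) (subdivide lab (d + 1)) _ (fun l' hl' => ?_)
        (faces_mem_supported l)
      rw [subdivide_single]
      refine supported_mono ?_ (subdivideList_mem_supported lab (d + 1) l'
        (by have := hl'.2; omega))
      rintro m ⟨h1, -, h3⟩
      refine ⟨h1, fun w hw hw1 => ?_⟩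
      obtain ⟨l'', h4, h5, rfl⟩ := h3 w hw
      exact hlab l hlS l'' (h4.trans hl'.1) h5 hw1
    have hb : boundary (subdivide lab (d + 1) (faces l) : List (ℕ × γ) →₀ R) = 0 := by
      have := eq_of_mem_supported (R := R) (boundary ∘ₗ subdivide lab (d + 1))
        (subdivide lab d ∘ₗ boundary) (fun l' hl' => ?_) (faces_mem_supported l)
      · simpa [boundary_faces] using this
      · simp [ih l' (hS l hlS l' hl'.1) (by have := hl'.2; omega)]
    rw [subdivideList_succ]
    have := eq_of_mem_supported (R := R) (boundary ∘ₗ join (lab l))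
        (LinearMap.id - join (lab l) ∘ₗ boundary) (fun m hm => ?_) hsupp
    · simpa [hb] using this
    · simp [boundary_insertList (lab l) m hm.1 hm.2]

theorem boundary_subdivide {lab : List (ℕ × γ) → ℕ × γ} {S : Set (List (ℕ × γ))}
    (hS : ∀ l ∈ S, ∀ l', l'.Sublist l → l' ∈ S)
    (hlab : ∀ l ∈ S, ∀ l', l'.Sublist l → l' ≠ [] → (lab l').1 = (lab l).1 → lab l' = lab l)
    (d : ℕ) {c : List (ℕ × γ) →₀ R}
    (hc : c ∈ supported R R {l | l ∈ S ∧ l.length = d + 1}) :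
    boundary (subdivide lab (d + 1) c) = subdivide lab d (boundary c) := by
  rw [← LinearMap.comp_apply, ← LinearMap.comp_apply]
  refine eq_of_mem_supported (R := R) _ _ (fun l hl => ?_) hc
  rw [LinearMap.comp_apply, LinearMap.comp_apply, subdivide_single, boundary_single,
    boundary_subdivideList hS hlab d l hl.1 hl.2]

theorem push_subdivideList {lab : List (ℕ × γ) → ℕ × γ} {S : Set (List (ℕ × γ))}
    (hS : ∀ l ∈ S, ∀ l', l'.Sublist l → l' ∈ S) {f : γ → γ}
    (hlab : ∀ l ∈ S, l ≠ [] → lab (l.map (Prod.map id f)) = Prod.map id f (lab l))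
    (d : ℕ) (l : List (ℕ × γ)) (hlS : l ∈ S) (hl : l.length = d) :
    push (Prod.map id f) (subdivideList lab d l : List (ℕ × γ) →₀ R) =
      subdivideList lab d (l.map (Prod.map id f)) := by
  induction d generalizing l with
  | zero => simp [subdivideList]
  | succ d ih =>
    rw [subdivideList_succ, push_join, subdivideList_succ,
      hlab l hlS (by rintro rfl; simp at hl), ← push_faces]
    congr 1
    rw [← LinearMap.comp_apply, ← LinearMap.comp_apply]
    refine eq_of_mem_supported (R := R) _ _ (fun l' hl' => ?_) (faces_mem_supported l)
    rw [LinearMap.comp_apply, LinearMap.comp_apply, subdivide_single, push_single,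
      subdivide_single, ih l' (hS l hlS l' hl'.1) (by have := hl'.2; omega)]

theorem push_subdivide {lab : List (ℕ × γ) → ℕ × γ} {S : Set (List (ℕ × γ))}
    (hS : ∀ l ∈ S, ∀ l', l'.Sublist l → l' ∈ S) {f : γ → γ}
    (hlab : ∀ l ∈ S, l ≠ [] → lab (l.map (Prod.map id f)) = Prod.map id f (lab l))
    (d : ℕ) {c : List (ℕ × γ) →₀ R} (hc : c ∈ supported R R {l | l ∈ S ∧ l.length = d}) :
    push (Prod.map id f) (subdivide lab d c) = subdivide lab d (push (Prod.map id f) c) := by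
  rw [← LinearMap.comp_apply, ← LinearMap.comp_apply]
  refine eq_of_mem_supported (R := R) _ _ (fun l hl => ?_) hc
  rw [LinearMap.comp_apply, LinearMap.comp_apply, subdivide_single, push_single,
    subdivide_single, push_subdivideList hS hlab d l hl.1 hl.2]

end ListChain

/-! ### The action of `ZMod p` on signed lists. -/

namespace ListChain

open Finsupp

variable {p : ℕ}

/-- Addition of `a` to the sign of a vertex. -/
def signShift (a : ZMod p) : ℕ × ZMod p → ℕ × ZMod p := Prod.map id (· + a)

theorem signShift_signShift (a b : ZMod p) (v : ℕ × ZMod p) :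
    signShift a (signShift b v) = signShift (b + a) v := by
  ext <;> simp [signShift, add_assoc]

theorem map_signShift_map_signShift (a b : ZMod p) (l : List (ℕ × ZMod p)) :
    (l.map (signShift b)).map (signShift a) = l.map (signShift (b + a)) := by
  simp [signShift_signShift]

theorem map_signShift_zero (l : List (ℕ × ZMod p)) : l.map (signShift 0) = l := by
  have : signShift (0 : ZMod p) = id := by
    ext v <;> simp [signShift]
  simp [this]

/-- The action of the generator of `ZMod p` on chains. -/
noncomputable def shift : Module.End (ZMod p) (List (ℕ × ZMod p) →₀ ZMod p) :=
  push (signShift 1)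

theorem shift_pow_single (j : ℕ) (l : List (ℕ × ZMod p)) (a : ZMod p) :
    (shift ^ j) (single l a) = single (l.map (signShift (j : ZMod p))) a := by
  induction j with
  | zero => simp [map_signShift_zero]
  | succ j ih =>
    rw [pow_succ', Module.End.mul_apply, ih, shift, push_single, map_signShift_map_signShift]
    simp

theorem shift_pow_self : (shift : Module.End (ZMod p) _) ^ p = 1 := by
  ext1 l
  ext1
  simp [shift_pow_single, map_signShift_zero]

/-- The alternating operators `ν - 1` and `1 + ν + ⋯ + ν ^ (p - 1)`. -/
noncomputable def rot (i : ℕ) : Module.End (ZMod p) (List (ℕ × ZMod p) →₀ ZMod p) :=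
  if Even i then shift - 1 else ∑ j ∈ Finset.range p, shift ^ j

/-- In either order the product of the two operators is `ν ^ p - 1 = 0`. -/
theorem rot_succ_rot (i : ℕ) (c : List (ℕ × ZMod p) →₀ ZMod p) : rot (i + 1) (rot i c) = 0 := by
  have : rot (i + 1) * rot i = (0 : Module.End (ZMod p) (List (ℕ × ZMod p) →₀ ZMod p)) := by
    by_cases hi : Even i
    · rw [rot, rot, if_neg (by simpa [Nat.even_add_one] using hi), if_pos hi]
      exact (geom_sum_mul (shift (p := p)) p).trans (by rw [shift_pow_self, sub_self])
    · rw [rot, rot, if_pos (by simpa [Nat.even_add_one] using hi), if_neg hi]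
      exact (mul_geom_sum (shift (p := p)) p).trans (by rw [shift_pow_self, sub_self])
  exact LinearMap.congr_fun this c

theorem rot_mem (Q : Submodule (ZMod p) (List (ℕ × ZMod p) →₀ ZMod p))
    (hQ : ∀ c ∈ Q, shift c ∈ Q) (i : ℕ) {c : List (ℕ × ZMod p) →₀ ZMod p} (hc : c ∈ Q) :
    rot i c ∈ Q := by
  have hpow (j : ℕ) : (shift ^ j) c ∈ Q := by
    induction j with
    | zero => simpa
    | succ j ih => rw [pow_succ', Module.End.mul_apply]; exact hQ _ ih
  rw [rot]
  split_ifs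
  · simpa using Q.sub_mem (hQ c hc) hc
  · simpa [LinearMap.sum_apply] using Q.sum_mem fun j _ => hpow j

/-- The invariant submodule `Q` is there because the labeling is assumed equivariant only on
`signedLists`. -/
theorem map_rot (Q : Submodule (ZMod p) (List (ℕ × ZMod p) →₀ ZMod p))
    (hQ : ∀ c ∈ Q, shift c ∈ Q) (F : Module.End (ZMod p) (List (ℕ × ZMod p) →₀ ZMod p))
    (hF : ∀ c ∈ Q, F (shift c) = shift (F c)) (i : ℕ)
    {c : List (ℕ × ZMod p) →₀ ZMod p} (hc : c ∈ Q) : F (rot i c) = rot i (F c) := by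
  have hpow (j : ℕ) : (shift ^ j) c ∈ Q ∧ F ((shift ^ j) c) = (shift ^ j) (F c) := by
    induction j with
    | zero => simpa
    | succ j ih =>
      rw [pow_succ', Module.End.mul_apply, Module.End.mul_apply]
      exact ⟨hQ _ ih.1, by rw [hF _ ih.1, ih.2]⟩
  rw [rot]
  split_ifs
  · simp [hF c hc]
  · simp [LinearMap.sum_apply, (hpow _).2]

theorem boundary_rot (i : ℕ) (c : List (ℕ × ZMod p) →₀ ZMod p) :
    boundary (rot i c) = rot i (boundary c) :=
  map_rot ⊤ (by simp) boundary (fun c _ => boundary_push _ c) i trivial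

/-- The sign of the first vertex of a list. -/
def headSign : List (ℕ × ZMod p) → ZMod p
  | [] => 0
  | v :: _ => v.2

theorem headSign_map_signShift (a : ZMod p) {l : List (ℕ × ZMod p)} (hl : l ≠ []) :
    headSign (l.map (signShift a)) = headSign l + a := by
  cases l with
  | nil => exact absurd rfl hl
  | cons v l => simp [headSign, signShift]

/-- Cochains on nonempty lists form a free module over the group ring: a cochain annihilated by
one of the two operators factors through the other one. -/
theorem exists_comp_rot_succ (hp : 1 < p) (i d : ℕ) (hd : d ≠ 0)
    (φ : (List (ℕ × ZMod p) →₀ ZMod p) →ₗ[ZMod p] ZMod p)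
    (hφ : ∀ l : List (ℕ × ZMod p), l.length = d → φ (rot i (single l 1)) = 0) :
    ∃ θ : (List (ℕ × ZMod p) →₀ ZMod p) →ₗ[ZMod p] ZMod p,
      ∀ l : List (ℕ × ZMod p), l.length = d → θ (rot (i + 1) (single l 1)) = φ (single l 1) := by
  have : Fact (1 < p) := ⟨hp⟩
  have : NeZero p := ⟨by omega⟩
  have hne {l : List (ℕ × ZMod p)} (hl : l.length = d) : l ≠ [] := by
    rintro rfl
    exact hd hl.symm
  by_cases hi : Even i
  -- Here `φ` is constant on orbits. Restricting it to lists of head sign 0 keeps one representative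
  -- per orbit, so the orbit sum recovers `φ`. Orbits are free because `d ≠ 0` excludes the empty
  -- list.
  · refine ⟨linearCombination (ZMod p) fun l => if headSign l = 0 then φ (single l 1) else 0,
      fun l hl => ?_⟩
    have hinv (j : ℕ) : φ (single (l.map (signShift (j : ZMod p))) 1) = φ (single l 1) := by
      induction j with
      | zero => simp [map_signShift_zero]
      | succ j ih =>
        have := hφ (l.map (signShift (j : ZMod p))) (by simpa using hl)
        rw [rot, if_pos hi, LinearMap.sub_apply, map_sub, sub_eq_zero, shift, push_single,
          map_signShift_map_signShift] at this
        simpa [ih] using this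
    rw [rot, if_neg (by simpa [Nat.even_add_one] using hi), LinearMap.sum_apply, map_sum,
      Finset.sum_eq_single_of_mem (-headSign l).val (Finset.mem_range.2 (ZMod.val_lt _))]
    · rw [shift_pow_single, linearCombination_single, headSign_map_signShift _ (hne hl), hinv]
      simp
    · intro j hj hj'
      rw [shift_pow_single, linearCombination_single, headSign_map_signShift _ (hne hl), if_neg]
      · simp
      · intro h
        apply hj'
        rw [← eq_neg_iff_add_eq_zero.2 ((add_comm _ _).trans h),
          ZMod.val_cast_of_lt (Finset.mem_range.1 hj)]
  -- Here `φ` sums to 0 over each orbit. The witness is its partial sum over the translates of head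
  -- sign `0, …, headSign l - 1`, so a shift adds the single term `φ l`.
  · refine ⟨linearCombination (ZMod p) fun l => ∑ j ∈ Finset.range (headSign l).val,
      φ (single (l.map (signShift ((j : ZMod p) - headSign l))) 1), fun l hl => ?_⟩
    have hsum : ∑ j ∈ Finset.range p,
        φ (single (l.map (signShift ((j : ZMod p) - headSign l))) 1) = 0 := by
      have := hφ (l.map (signShift (- headSign l))) (by simpa using hl)
      rw [rot, if_neg hi, LinearMap.sum_apply, map_sum] at this
      rw [← this]
      refine Finset.sum_congr rfl fun j _ => ?_
      rw [shift_pow_single, map_signShift_map_signShift]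
      congr 4
      ring_nf
    rw [rot, if_pos (by simpa [Nat.even_add_one] using hi), LinearMap.sub_apply, map_sub, shift,
      push_single, Module.End.one_apply, linearCombination_single, linearCombination_single,
      headSign_map_signShift _ (hne hl), one_smul, one_smul]
    simp only [map_signShift_map_signShift]
    have hj (j : ℕ) : 1 + ((j : ZMod p) - (headSign l + 1)) = j - headSign l := by ring
    simp only [hj]
    have hlast : φ (single (l.map (signShift (((headSign l).val : ZMod p) - headSign l))) 1) =
        φ (single l 1) := by
      simp [map_signShift_zero]
    -- When the head sign wraps from `p - 1` to 0, the partial sum restarts at 0; the vanishing of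
    -- the full orbit sum accounts for it.
    rcases (Nat.succ_le_of_lt (ZMod.val_lt (headSign l))).lt_or_eq with h | h
    · have : (headSign l + 1).val = (headSign l).val + 1 := by
        rw [ZMod.val_add_of_lt] <;> rw [ZMod.val_one]
        exact h
      rw [this, Finset.sum_range_succ, add_sub_cancel_left, hlast]
    · have : (headSign l + 1).val = 0 := by
        rw [ZMod.val_add, ZMod.val_one, ← Nat.succ_eq_add_one, h, Nat.mod_self]
      rw [this, Finset.range_zero, Finset.sum_empty, ← hsum]
      conv_lhs => enter [1, 1]; rw [← h]
      rw [Finset.sum_range_succ, hlast]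
      simp

/-! ### The `ZMod p`-Tucker lemma. -/

/-- The lists of vertices with strictly decreasing levels between `1` and `n`; these are the faces
of the `n`-fold join of `ZMod p`. -/
def signedLists (p n : ℕ) : Set (List (ℕ × ZMod p)) :=
  {l | l.Pairwise (fun a b => b.1 < a.1) ∧ ∀ v ∈ l, v.1 ∈ Finset.Icc 1 n}

theorem signedLists_of_sublist {n : ℕ} : ∀ l ∈ signedLists p n, ∀ l', l'.Sublist l →
    l' ∈ signedLists p n :=
  fun _ hl _ h => ⟨hl.1.sublist h, fun v hv => hl.2 v (h.subset hv)⟩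

theorem shift_mem_supported {n d : ℕ} (c : List (ℕ × ZMod p) →₀ ZMod p)
    (hc : c ∈ supported (ZMod p) (ZMod p) {l | l ∈ signedLists p n ∧ l.length = d}) :
    shift c ∈ supported (ZMod p) (ZMod p) {l | l ∈ signedLists p n ∧ l.length = d} := by
  refine map_mem_of_mem_supported shift _ (fun l hl => ?_) hc
  rw [shift, push_single]
  refine single_mem_supported _ _ ⟨⟨?_, ?_⟩, by simpa using hl.2⟩
  · rw [List.pairwise_map]
    exact hl.1.1
  · intro v hv
    obtain ⟨w, hw, rfl⟩ := List.mem_map.1 hv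
    exact hl.1.2 w hw

/-- Chains in the joins of copies of `ZMod p`, each cobounding an operator applied to the previous
one. -/
noncomputable def sphereChain (p : ℕ) : ℕ → (List (ℕ × ZMod p) →₀ ZMod p)
  | 0 => single [(1, 0)] 1
  | i + 1 => cone (i + 2, 0) (rot i (sphereChain p i))

theorem sphereChain_mem_supported (i : ℕ) : sphereChain p i ∈ supported (ZMod p) (ZMod p)
    {l | l ∈ signedLists p (i + 1) ∧ l.length = i + 1} := by
  induction i with
  | zero => exact single_mem_supported _ _ (by simp [signedLists])
  | succ i ih =>
    refine map_mem_of_mem_supported (cone (i + 2, 0)) _ (fun l hl => ?_)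
      (rot_mem _ shift_mem_supported i ih)
    rw [cone_single]
    refine single_mem_supported _ _ ⟨⟨?_, ?_⟩, by simp [hl.2]⟩
    · refine List.pairwise_cons.2 ⟨fun v hv => ?_, hl.1.1⟩
      have := Finset.mem_Icc.1 (hl.1.2 v hv)
      show v.1 < i + 2
      omega
    · intro v hv
      rcases List.mem_cons.1 hv with rfl | hv
      · simp
      · have := Finset.mem_Icc.1 (hl.1.2 v hv)
        exact Finset.mem_Icc.2 ⟨by omega, by omega⟩

/-- The cone over `rot i (sphereChain p i)` has this base as boundary once the base is a cycle. For
`i = 0` the shift fixes the empty list; later two consecutive operators compose to 0. -/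
theorem boundary_sphereChain_succ (i : ℕ) :
    boundary (sphereChain p (i + 1)) = rot i (sphereChain p i) := by
  have hzero : rot i (boundary (sphereChain p i)) = 0 := by
    induction i with
    | zero => simp [sphereChain, faces, rot, shift]
    | succ i ih =>
      rw [sphereChain, boundary_cone, boundary_rot, ih, map_zero, sub_zero, rot_succ_rot]
  rw [sphereChain, boundary_cone, boundary_rot, hzero, map_zero, sub_zero]

/-- **The `ZMod p`-Tucker lemma**: an equivariant labeling of the faces of the `n`-fold join of
`ZMod p` by vertices of the `N`-fold join, in which comparable faces with labels in the same copy
have the same label, exists only if `n ≤ N`. -/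
theorem le_of_equivariant_labeling (hp : 1 < p) {n N : ℕ}
    (lab : List (ℕ × ZMod p) → ℕ × ZMod p)
    (hshift : ∀ l ∈ signedLists p n, l ≠ [] → lab (l.map (signShift 1)) = signShift 1 (lab l))
    (hlevel : ∀ l ∈ signedLists p n, l ≠ [] → (lab l).1 ∈ Finset.Icc 1 N)
    (hlab : ∀ l ∈ signedLists p n, ∀ l', l'.Sublist l → l' ≠ [] →
      (lab l').1 = (lab l).1 → lab l' = lab l) : n ≤ N := by
  by_contra! hn
  have hsupp {i : ℕ} (hi : i < n) : sphereChain p i ∈ supported (ZMod p) (ZMod p)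
      {l | l ∈ signedLists p n ∧ l.length = i + 1} := by
    refine supported_mono ?_ (sphereChain_mem_supported i)
    rintro l ⟨⟨h1, h2⟩, h3⟩
    exact ⟨⟨h1, fun v hv => Finset.Icc_subset_Icc le_rfl (by omega) (h2 v hv)⟩, h3⟩
  -- Since `θ ∘ rot i ∘ boundary` vanishes, `θ ∘ boundary` factors as `θ' ∘ rot (i + 1)`. The
  -- boundary formula for `sphereChain` then carries the value 1 from `θ` to `θ'`.
  have key (i : ℕ) (hi : i < n) : ∃ θ : (List (ℕ × ZMod p) →₀ ZMod p) →ₗ[ZMod p] ZMod p,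
      θ (rot i (subdivide lab (i + 1) (sphereChain p i))) = 1 ∧
      ∀ l : List (ℕ × ZMod p), l.length = i + 2 → θ (rot i (boundary (single l 1))) = 0 := by
    induction i with
    | zero =>
      -- A shift raises the head sign by 1, so `headSign ∘ (ν - 1)` is 1 on every vertex and 0 on
      -- the boundary of every edge.
      refine ⟨linearCombination (ZMod p) headSign, ?_, fun l hl => ?_⟩
      · simp [sphereChain, subdivideList, faces, insertList, rot, shift, headSign, signShift,
          linearCombination_single]
      · obtain ⟨a, b, rfl⟩ := List.length_eq_two.1 hl
        simp [faces, rot, shift, headSign, signShift, linearCombination_single]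
    | succ i ih =>
      obtain ⟨θ, h1, h2⟩ := ih (by omega)
      obtain ⟨θ', h'⟩ := exists_comp_rot_succ hp i (i + 2) (by omega) (θ ∘ₗ boundary)
        (fun l hl => by rw [LinearMap.comp_apply, boundary_rot, h2 l hl])
      refine ⟨θ', ?_, fun l hl => ?_⟩
      · have hmem : subdivide lab (i + 2) (sphereChain p (i + 1)) ∈
            supported (ZMod p) (ZMod p) {l : List (ℕ × ZMod p) | l.length = i + 2} := by
          refine map_mem_of_mem_supported (subdivide lab (i + 2)) _ (fun l hl => ?_) (hsupp hi)
          rw [subdivide_single]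
          exact supported_mono (fun m hm => hm.2.1) (subdivideList_mem_supported lab _ l hl.2)
        have := eq_of_mem_supported (θ' ∘ₗ rot (i + 1)) (θ ∘ₗ boundary) h' hmem
        rw [LinearMap.comp_apply, LinearMap.comp_apply,
          boundary_subdivide signedLists_of_sublist hlab (i + 1) (hsupp hi),
          boundary_sphereChain_succ,
          map_rot _ shift_mem_supported (subdivide lab (i + 1)) (fun c hc =>
            (push_subdivide signedLists_of_sublist hshift _ hc).symm) i (hsupp (by omega)),
          h1] at this
        exact this
      · have := eq_of_mem_supported (θ' ∘ₗ rot (i + 1)) (θ ∘ₗ boundary) h'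
          (supported_mono (fun m hm => ?_) (faces_mem_supported (R := ZMod p) l))
        · simpa [boundary_faces] using this
        · have := hm.2
          show m.length = i + 2
          omega
  obtain ⟨θ, h, -⟩ := key (n - 1) (by omega)
  -- A list in the support would have `n` distinct levels in `Icc 1 N`, while `N < n`.
  have hzero : subdivide lab (n - 1 + 1) (sphereChain p (n - 1)) = 0 := by
    refine (Submodule.mem_bot (ZMod p)).1 (map_mem_of_mem_supported
      (subdivide lab (n - 1 + 1)) _ (fun l hl => ?_) (hsupp (show n - 1 < n by omega)))
    have := supported_mono (s := _) (t := ∅) (fun m hm => ?_)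
      (subdivideList_mem_supported (R := ZMod p) lab _ l hl.2)
    · simpa [supported_empty] using this
    · exfalso
      have hnd : (m.map Prod.fst).Nodup := by
        rw [List.Nodup, List.pairwise_map]
        exact hm.1.imp fun h => h.ne
      have hsub : (m.map Prod.fst).toFinset ⊆ Finset.Icc 1 N := by
        intro x hx
        obtain ⟨w, hw, rfl⟩ := List.mem_map.1 (List.mem_toFinset.1 hx)
        obtain ⟨l', h1, h2, rfl⟩ := hm.2.2 w hw
        exact hlevel l' (signedLists_of_sublist l hl.1 l' h1) h2
      have hcard := Finset.card_le_card hsub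
      rw [List.toFinset_card_of_nodup hnd, List.length_map, hm.2.1, Nat.card_Icc] at hcard
      omega
  have : Fact (1 < p) := ⟨hp⟩
  rw [hzero, map_zero, map_zero] at h
  exact zero_ne_one h

end ListChain

/-! ### The prime case, with gap 2. -/

namespace StableKneser

open ListChain

/-- Every coloring with `t` colors of the almost `s`-stable `k`-subsets of `[n]` has `r` pairwise
disjoint sets of the same color, whenever `n` exceeds `(r - 1) t + (k - 1) r`. -/
def ForcesMonochromatic (r s : ℕ) : Prop :=
  ∀ (n k t : ℕ) (c : Finset ℕ → ℕ), 1 ≤ k → 1 ≤ t → (r - 1) * t + (k - 1) * r + 1 ≤ n →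
    (∀ S ∈ almostStableSets n k s, c S < t) →
    ∃ j < t, ∃ f : Fin r → Finset ℕ,
      (∀ i, f i ∈ almostStableSets n k s ∧ c (f i) = j) ∧ Pairwise (Function.onFun Disjoint f)

variable {p : ℕ}

theorem ne_of_mem_signedLists {n : ℕ} {l : List (ℕ × ZMod p)} (hl : l ∈ signedLists p n)
    {a b : ℕ × ZMod p} (ha : a ∈ l) (hb : b ∈ l) (hab : a ≠ b) : a.1 ≠ b.1 := by
  have : Std.Symm fun a b : ℕ × ZMod p => a.1 ≠ b.1 := ⟨fun _ _ h => h.symm⟩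
  exact (hl.1.imp (S := fun a b => a.1 ≠ b.1) fun h => h.ne').forall ha hb hab

/-- The set of levels at which the list `l` has the sign `s`. -/
def levels (l : List (ℕ × ZMod p)) (s : ZMod p) : Finset ℕ :=
  ((l.filter (fun v => v.2 = s)).map Prod.fst).toFinset

theorem mem_levels {l : List (ℕ × ZMod p)} {s : ZMod p} {x : ℕ} :
    x ∈ levels l s ↔ (x, s) ∈ l := by
  simp [levels]

theorem levels_map_signShift (l : List (ℕ × ZMod p)) (s : ZMod p) :
    levels (l.map (signShift 1)) (s + 1) = levels l s := by
  ext x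
  simp [mem_levels, signShift]

theorem disjoint_levels {n : ℕ} {l : List (ℕ × ZMod p)} (hl : l ∈ signedLists p n)
    {s s' : ZMod p} (h : s ≠ s') : Disjoint (levels l s) (levels l s') := by
  rw [Finset.disjoint_left]
  intro x hx hx'
  exact ne_of_mem_signedLists hl (mem_levels.1 hx) (mem_levels.1 hx') (by simpa using h) rfl

open Classical in
/-- The signs `s` such that the levels of sign `s` contain an almost 2-stable set of color `j`. -/
noncomputable def colorSigns [NeZero p] (n k : ℕ) (c : Finset ℕ → ℕ) (l : List (ℕ × ZMod p))
    (j : ℕ) : Finset (ZMod p) :=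
  Finset.univ.filter fun s => ∃ S ∈ almostStableSets n k 2, S ⊆ levels l s ∧ c S = j

theorem mem_colorSigns [NeZero p] {n k : ℕ} {c : Finset ℕ → ℕ} {l : List (ℕ × ZMod p)} {j : ℕ}
    {s : ZMod p} : s ∈ colorSigns n k c l j ↔
      ∃ S ∈ almostStableSets n k 2, S ⊆ levels l s ∧ c S = j := by
  simp [colorSigns]

theorem colorSigns_map_signShift [NeZero p] (n k : ℕ) (c : Finset ℕ → ℕ)
    (l : List (ℕ × ZMod p)) (j : ℕ) :
    colorSigns n k c (l.map (signShift 1)) j =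
      (colorSigns n k c l j).map (addRightEmbedding 1) := by
  ext s
  simp only [Finset.mem_map, mem_colorSigns, addRightEmbedding_apply]
  constructor
  · intro h
    refine ⟨s - 1, ?_, by ring⟩
    rwa [← levels_map_signShift, sub_add_cancel]
  · rintro ⟨s, h, rfl⟩
    rwa [levels_map_signShift]

theorem colorSigns_mono [NeZero p] (n k : ℕ) (c : Finset ℕ → ℕ) {l l' : List (ℕ × ZMod p)}
    (h : l'.Sublist l) (j : ℕ) : colorSigns n k c l' j ⊆ colorSigns n k c l j := by
  intro s hs
  obtain ⟨S, h1, h2, h3⟩ := mem_colorSigns.1 hs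
  exact mem_colorSigns.2
    ⟨S, h1, fun x hx => mem_levels.2 (h.subset (mem_levels.1 (h2 hx))), h3⟩

/-- The number of maximal blocks of equal signs in a list. -/
def alternation (l : List (ℕ × ZMod p)) : ℕ := ((l.map Prod.snd).destutter (· ≠ ·)).length

theorem alternation_map_signShift (l : List (ℕ × ZMod p)) :
    alternation (l.map (signShift 1)) = alternation l := by
  have : (l.map (signShift 1)).map Prod.snd = (l.map Prod.snd).map (· + 1) := by
    simp [signShift, Function.comp_def]
  have h := List.map_destutter_ne (l := l.map Prod.snd) (add_left_injective (1 : ZMod p))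
  rw [alternation, this, ← h, List.length_map, alternation]

theorem alternation_mono {l l' : List (ℕ × ZMod p)} (h : l'.Sublist l) :
    alternation l' ≤ alternation l :=
  (List.isChain_destutter _ _).length_le_length_destutter_ne
    ((List.destutter_sublist _ _).trans (h.map _))

theorem one_le_alternation {l : List (ℕ × ZMod p)} (hl : l ≠ []) : 1 ≤ alternation l := by
  rw [alternation, Nat.one_le_iff_ne_zero, Ne, List.length_eq_zero_iff, List.destutter_eq_nil]
  simpa using hl

/-- If the signs differed, the head of `l` could be put in front of an alternating sublist of `l'`
of maximal length, giving `l` a larger alternation. -/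
theorem headSign_eq_of_alternation_eq {l l' : List (ℕ × ZMod p)} (h : l'.Sublist l)
    (hl' : l' ≠ []) (heq : alternation l' = alternation l) : headSign l' = headSign l := by
  cases h with
  | slnil => rfl
  | cons_cons => rfl
  | @cons _ l v h =>
    obtain ⟨w, m, rfl⟩ := List.exists_cons_of_ne_nil hl'
    by_contra hne
    have hhead (a : ZMod p) (m : List (ZMod p)) :
        ∃ m', (a :: m).destutter (· ≠ ·) = a :: m' := by
      rw [List.destutter_cons']
      induction m with
      | nil => exact ⟨[], rfl⟩
      | cons b m ih =>
        rw [List.destutter'_cons]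
        split_ifs
        · exact ⟨_, rfl⟩
        · exact ih
    obtain ⟨m', hm'⟩ := hhead w.2 (m.map Prod.snd)
    have hc : (v.2 :: ((w :: m).map Prod.snd).destutter (· ≠ ·)).IsChain (· ≠ ·) := by
      have := List.isChain_destutter (· ≠ ·) ((w :: m).map Prod.snd)
      rw [List.map_cons, hm'] at this ⊢
      exact List.isChain_cons_cons.2 ⟨fun h => hne h.symm, this⟩
    have := hc.length_le_length_destutter_ne (l₂ := (v :: l).map Prod.snd)
      (((List.destutter_sublist _ _).trans (h.map _)).cons_cons _)
    rw [List.length_cons] at this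
    rw [alternation, alternation] at heq
    omega

/-- Entries of equal sign are not adjacent, so another level lies strictly between them. This is the
source of the gap 2. -/
theorem pairwise_of_isChain {l : List (ℕ × ZMod p)}
    (hl : l.Pairwise (fun a b => b.1 < a.1)) (hc : l.IsChain (fun a b => a.2 ≠ b.2)) :
    l.Pairwise (fun a b => a.2 = b.2 → b.1 + 2 ≤ a.1) := by
  induction l with
  | nil => simp
  | cons a l ih =>
    rw [List.pairwise_cons] at hl ⊢
    refine ⟨fun b hb hab => ?_, ih hl.2 hc.tail⟩
    cases l with
    | nil => simp at hb
    | cons d l =>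
      rcases List.mem_cons.1 hb with rfl | hb
      · exact absurd hab (List.isChain_cons_cons.1 hc).1
      · have h1 := hl.1 d (by simp)
        have h2 := (List.pairwise_cons.1 hl.2).1 b hb
        omega

/-- Pigeonhole on a maximal alternating sublist: some sign occurs at least `k` times, and its levels
are 2-stable. -/
theorem exists_subset_levels [NeZero p] {n k : ℕ} {l : List (ℕ × ZMod p)}
    (hl : l ∈ signedLists p n) (halt : p * (k - 1) < alternation l) :
    ∃ s, ∃ S ∈ almostStableSets n k 2, S ⊆ levels l s := by
  classical
  set d := l.destutter (fun a b => a.2 ≠ b.2)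
  have hdl : d.Sublist l := List.destutter_sublist _ _
  have hdS : d ∈ signedLists p n := signedLists_of_sublist l hl d hdl
  have hlen : d.length = alternation l := by
    rw [alternation, ← List.map_destutter (R := fun a b : ℕ × ZMod p => a.2 ≠ b.2)
      (fun _ _ _ _ => Iff.rfl), List.length_map]
  have hpw := pairwise_of_isChain hdS.1 (List.isChain_destutter _ _)
  have hstab : ∀ a ∈ d, ∀ b ∈ d, a ≠ b → a.2 = b.2 → (2 : ℤ) ≤ |(a.1 : ℤ) - b.1| := by
    intro a ha b hb hab
    have : Std.Symm fun a b : ℕ × ZMod p => a.2 = b.2 → (2 : ℤ) ≤ |(a.1 : ℤ) - b.1| :=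
      ⟨fun a b h hab => by rw [abs_sub_comm]; exact h hab.symm⟩
    refine (hpw.imp (S := fun a b => a.2 = b.2 → (2 : ℤ) ≤ |(a.1 : ℤ) - b.1|) ?_).forall ha hb hab
    intro a b h hab
    have := h hab
    exact le_abs.2 (Or.inl (by omega))
  have hnd : d.Nodup := hdS.1.imp fun h h' => by rw [h'] at h; exact lt_irrefl _ h
  obtain ⟨s, -, hs⟩ := Finset.exists_lt_card_fiber_of_mul_lt_card_of_maps_to
    (s := d.toFinset) (t := (Finset.univ : Finset (ZMod p))) (f := Prod.snd) (n := k - 1)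
    (fun _ _ => Finset.mem_univ _)
    (by rw [List.toFinset_card_of_nodup hnd, hlen, Finset.card_univ, ZMod.card]; exact halt)
  have hinj : Set.InjOn Prod.fst (d.toFinset.filter fun v => v.2 = s : Set (ℕ × ZMod p)) := by
    intro a ha b hb h
    simp only [Finset.coe_filter, List.mem_toFinset, Set.mem_ofPred_eq] at ha hb
    exact Prod.ext h (ha.2.trans hb.2.symm)
  obtain ⟨S, hS, hSk⟩ := Finset.exists_subset_card_eq
    (s := (d.toFinset.filter fun v => v.2 = s).image Prod.fst) (n := k)
    (by rw [Finset.card_image_of_injOn hinj]; omega)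
  have hSd : ∀ x ∈ S, (x, s) ∈ d := by
    intro x hx
    obtain ⟨v, hv, rfl⟩ := Finset.mem_image.1 (hS hx)
    obtain ⟨h1, rfl⟩ := Finset.mem_filter.1 hv
    exact List.mem_toFinset.1 h1
  refine ⟨s, S, ⟨fun x hx => hdS.2 _ (hSd x hx), hSk, fun x hx y hy hxy => ?_⟩,
    fun x hx => mem_levels.2 (hdl.subset (hSd x hx))⟩
  exact_mod_cast hstab _ (hSd x hx) _ (hSd y hy) (by simpa using hxy) rfl

/-- A sign attached to a family of sets of signs: the average of the first nonempty set. -/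
noncomputable def averageSign [Fact p.Prime] (A : ℕ → Finset (ZMod p)) : ZMod p :=
  (∑ x ∈ A (sInf {j | (A j).Nonempty}), x) / (A (sInf {j | (A j).Nonempty})).card

/-- A nonempty proper subset of `ZMod p` has cardinality invertible mod `p`, so translating it by 1
moves its average by 1. -/
theorem averageSign_map_add_one [Fact p.Prime] (A : ℕ → Finset (ZMod p))
    (hne : ∃ j, (A j).Nonempty) (hA : ∀ j, A j ≠ Finset.univ) :
    averageSign (fun j => (A j).map (addRightEmbedding 1)) = averageSign A + 1 := by
  have hset : {j | ((A j).map (addRightEmbedding 1)).Nonempty} = {j | (A j).Nonempty} := by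
    simp
  have hmem : (A (sInf {j | (A j).Nonempty})).Nonempty := Nat.sInf_mem hne
  rw [averageSign, hset, averageSign]
  set B := A (sInf {j | (A j).Nonempty})
  have hcard : (B.card : ZMod p) ≠ 0 := by
    rw [Ne, ZMod.natCast_eq_zero_iff]
    intro h
    have h1 := Nat.le_of_dvd (Finset.card_pos.2 hmem) h
    have h2 := (Finset.card_lt_iff_ne_univ B).2 (hA _)
    rw [ZMod.card] at h2
    omega
  rw [Finset.sum_map, Finset.card_map]
  simp only [addRightEmbedding_apply, Finset.sum_add_distrib, Finset.sum_const, nsmul_eq_mul,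
    mul_one]
  rw [add_div, div_self hcard]

theorem forcesMonochromatic_of_prime (hp : p.Prime) : ForcesMonochromatic p 2 := by
  intro n k t c hk ht hn hc
  have : Fact p.Prime := ⟨hp⟩
  by_contra hcon
  -- If every sign realized color `j`, the `p` disjoint level sets would contain `p` disjoint sets
  -- of color `j`.
  have hproper : ∀ l ∈ signedLists p n, ∀ j, colorSigns n k c l j ≠ Finset.univ := by
    intro l hl j hj
    have hex : ∀ s : ZMod p, ∃ S ∈ almostStableSets n k 2, S ⊆ levels l s ∧ c S = j :=
      fun s => mem_colorSigns.1 (hj ▸ Finset.mem_univ s)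
    choose g hg1 hg2 hg3 using hex
    refine hcon ⟨j, hg3 0 ▸ hc _ (hg1 0),
      fun i => g ((Fintype.equivFinOfCardEq (ZMod.card p)).symm i),
      fun i => ⟨hg1 _, hg3 _⟩, fun i i' hii' => ?_⟩
    exact Finset.disjoint_of_subset_left (hg2 _) (Finset.disjoint_of_subset_right (hg2 _)
      (disjoint_levels hl (by simpa using hii')))
  have hempty : ∀ (l : List (ℕ × ZMod p)) j, (colorSigns n k c l j).Nonempty → j < t := by
    rintro l j ⟨s, hs⟩
    obtain ⟨S, h1, -, rfl⟩ := mem_colorSigns.1 hs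
    exact hc S h1
  have hne : ∀ l ∈ signedLists p n, p * (k - 1) < alternation l →
      ∃ j, (colorSigns n k c l j).Nonempty := by
    intro l hl h
    obtain ⟨s, S, hS, hSl⟩ := exists_subset_levels hl h
    exact ⟨c S, s, mem_colorSigns.2 ⟨S, hS, hSl, rfl⟩⟩
  have hpos : ∀ l ∈ signedLists p n, p * (k - 1) < alternation l →
      0 < ∑ j ∈ Finset.range t, (colorSigns n k c l j).card := by
    intro l hl h
    obtain ⟨j, hj⟩ := hne l hl h
    exact Finset.sum_pos' (fun _ _ => Nat.zero_le _)
      ⟨j, Finset.mem_range.2 (hempty l j hj), Finset.card_pos.2 hj⟩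
  have hle := le_of_equivariant_labeling hp.one_lt (n := n) (N := p * (k - 1) + t * (p - 1))
    -- The short labels use levels up to `p * (k - 1)`. Each of the `t` colors adds at most `p - 1`
    -- further levels, by `hproper`.
    (fun l => if alternation l ≤ p * (k - 1) then (alternation l, headSign l)
      else (p * (k - 1) + ∑ j ∈ Finset.range t, (colorSigns n k c l j).card,
        averageSign (colorSigns n k c l))) ?_ ?_ ?_
  · have h1 := mul_comm p (k - 1)
    have h2 := mul_comm t (p - 1)
    omega
  · intro l hl hl0
    simp only [alternation_map_signShift]
    split_ifs with h
    · rw [headSign_map_signShift _ hl0]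
      rfl
    · have hcs : colorSigns n k c (l.map (signShift 1)) =
          fun j => (colorSigns n k c l j).map (addRightEmbedding 1) :=
        funext fun j => colorSigns_map_signShift n k c l j
      rw [hcs, averageSign_map_add_one _ (hne l hl (by omega)) (hproper l hl)]
      simp [signShift]
  · intro l hl hl0
    split_ifs with h
    · exact Finset.mem_Icc.2 ⟨one_le_alternation hl0, by dsimp only; omega⟩
    · refine Finset.mem_Icc.2 ⟨?_, ?_⟩
      · have := hpos l hl (by omega)
        dsimp only
        omega
      · dsimp only
        have : ∑ j ∈ Finset.range t, (colorSigns n k c l j).card ≤ t * (p - 1) := by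
          refine (Finset.sum_le_card_nsmul _ _ (p - 1) fun j _ => ?_).trans (by simp)
          have := (Finset.card_lt_iff_ne_univ _).2 (hproper l hl j)
          rw [ZMod.card] at this
          omega
        omega
  · intro l hl l' hl' hl0
    have hmono := alternation_mono hl'
    split_ifs with h1 h2 h2
    · intro h
      exact Prod.ext h (headSign_eq_of_alternation_eq hl' hl0 h)
    · have := hpos l hl (by omega)
      dsimp only
      omega
    · omega
    · intro h
      have hsum := Nat.add_left_cancel h
      have hsub := fun j => colorSigns_mono n k c hl' j
      -- The sets grow with the list, so equal total cardinality forces each of them to be equal,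
      -- and hence the average sign too.
      have heq : colorSigns n k c l' = colorSigns n k c l := by
        funext j
        by_cases hj : j < t
        · refine Finset.eq_of_subset_of_card_le (hsub j) (le_of_eq ?_)
          exact ((Finset.sum_eq_sum_iff_of_le fun j _ => Finset.card_le_card (hsub j)).1 hsum j
            (Finset.mem_range.2 hj)).symm
        · rw [Finset.not_nonempty_iff_eq_empty.1 fun h => hj (hempty l' j h),
            Finset.not_nonempty_iff_eq_empty.1 fun h => hj (hempty l j h)]
      rw [heq]

end StableKneser

/-! ### Composition of gaps and reduction to primes. -/

namespace StableKneser

theorem forcesMonochromatic_one : ForcesMonochromatic 1 1 := by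
  intro n k t c hk ht hn hc
  have hmem : Finset.Icc 1 k ∈ almostStableSets n k 1 := by
    refine ⟨Finset.Icc_subset_Icc le_rfl (by omega), by simp, fun i _ j _ hij => ?_⟩
    have : (i : ℤ) - j ≠ 0 := sub_ne_zero.2 (by exact_mod_cast hij)
    exact_mod_cast Int.one_le_abs this
  exact ⟨_, hc _ hmem, fun _ => Finset.Icc 1 k, fun _ => ⟨hmem, rfl⟩,
    fun i j hij => absurd (Subsingleton.elim i j) hij⟩

/-- The subset of `A` whose positions in the increasing enumeration of `A`, starting from `1`,
are the elements of `S`. -/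
noncomputable def subsetAt (A S : Finset ℕ) : Finset ℕ :=
  A.filter fun x => (A.filter (· ≤ x)).card ∈ S

theorem subsetAt_subset (A S : Finset ℕ) : subsetAt A S ⊆ A := Finset.filter_subset _ _

theorem strictMonoOn_card_filter_le (A : Finset ℕ) :
    StrictMonoOn (fun x => (A.filter (· ≤ x)).card) (A : Set ℕ) := by
  intro x _ y hy hxy
  refine Finset.card_lt_card ((Finset.ssubset_iff_of_subset ?_).2 ⟨y, ?_, ?_⟩)
  · exact fun z hz => by simp only [Finset.mem_filter] at hz ⊢; exact ⟨hz.1, by omega⟩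
  · simpa using hy
  · simp [hxy]

theorem image_card_filter_le (A : Finset ℕ) :
    A.image (fun x => (A.filter (· ≤ x)).card) = Finset.Icc 1 A.card := by
  refine Finset.eq_of_subset_of_card_le (fun m hm => ?_) ?_
  · obtain ⟨x, hx, rfl⟩ := Finset.mem_image.1 hm
    exact Finset.mem_Icc.2 ⟨Finset.card_pos.2 ⟨x, by simpa using hx⟩,
      Finset.card_le_card (Finset.filter_subset _ _)⟩
  · rw [Finset.card_image_of_injOn (strictMonoOn_card_filter_le A).injOn]
    simp

theorem image_subsetAt {A S : Finset ℕ} (hS : S ⊆ Finset.Icc 1 A.card) :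
    (subsetAt A S).image (fun x => (A.filter (· ≤ x)).card) = S := by
  ext m
  simp only [subsetAt, Finset.mem_image, Finset.mem_filter]
  constructor
  · rintro ⟨x, ⟨-, h⟩, rfl⟩
    exact h
  · intro hm
    have := hS hm
    rw [← image_card_filter_le, Finset.mem_image] at this
    obtain ⟨x, hx, rfl⟩ := this
    exact ⟨x, ⟨hx, hm⟩, rfl⟩

theorem card_subsetAt {A S : Finset ℕ} (hS : S ⊆ Finset.Icc 1 A.card) :
    (subsetAt A S).card = S.card := by
  conv_rhs => rw [← image_subsetAt hS]
  exact (Finset.card_image_of_injOn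
    ((strictMonoOn_card_filter_le A).injOn.mono (by exact_mod_cast subsetAt_subset A S))).symm

theorem disjoint_subsetAt (A : Finset ℕ) {S T : Finset ℕ} (h : Disjoint S T) :
    Disjoint (subsetAt A S) (subsetAt A T) := by
  rw [Finset.disjoint_left] at h ⊢
  intro x hx hx'
  exact h (Finset.mem_filter.1 hx).2 (Finset.mem_filter.1 hx').2

/-- In an almost `s`-stable set, elements whose positions differ by `m` differ by at least
`s * m`. -/
theorem mul_card_filter_sub_le {A : Finset ℕ} {s : ℕ}
    (hA : ∀ i ∈ A, ∀ j ∈ A, i < j → i + s ≤ j) {x : ℕ} (hx : x ∈ A) (m : ℕ) :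
    ∀ y ∈ A, (A.filter (· ≤ y)).card = (A.filter (· ≤ x)).card + m → x + s * m ≤ y := by
  induction m with
  | zero =>
    intro y hy h
    rw [(strictMonoOn_card_filter_le A).injOn hy hx h]
    simp
  | succ m ih =>
    intro y hy h
    have hmem : (A.filter (· ≤ x)).card + m ∈ Finset.Icc 1 A.card := by
      have h1 : 0 < (A.filter (· ≤ x)).card := Finset.card_pos.2 ⟨x, by simpa using hx⟩
      have h2 := Finset.card_le_card (Finset.filter_subset (· ≤ y) A)
      exact Finset.mem_Icc.2 ⟨by omega, by omega⟩
    rw [← image_card_filter_le, Finset.mem_image] at hmem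
    obtain ⟨z, hz, hzm⟩ := hmem
    have h1 := ih z hz hzm
    have h2 : z < y := ((strictMonoOn_card_filter_le A).lt_iff_lt hz hy).1
      (show (A.filter (· ≤ z)).card < (A.filter (· ≤ y)).card by omega)
    have h3 := hA z hz y hy h2
    rw [Nat.mul_succ]
    omega

/-- Positions in `A` at least `s` apart correspond to elements at least `s * s'` apart, so gaps
multiply. -/
theorem subsetAt_mem_almostStableSets {n m k s s' : ℕ} {A S : Finset ℕ}
    (hA : A ∈ almostStableSets n m s') (hS : S ∈ almostStableSets m k s) :
    subsetAt A S ∈ almostStableSets n k (s * s') := by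
  obtain ⟨hA1, hA2, hA3⟩ := hA
  obtain ⟨hS1, hS2, hS3⟩ := hS
  have hgap : ∀ i ∈ A, ∀ j ∈ A, i < j → i + s' ≤ j := by
    intro i hi j hj hij
    have := hA3 j hj i hi hij.ne'
    rw [abs_of_pos (by omega)] at this
    omega
  have hlt : ∀ i ∈ subsetAt A S, ∀ j ∈ subsetAt A S, i < j →
      ((s * s' : ℕ) : ℤ) ≤ (j : ℤ) - i := by
    intro i hi j hj hij
    obtain ⟨hiA, hiS⟩ := Finset.mem_filter.1 hi
    obtain ⟨hjA, hjS⟩ := Finset.mem_filter.1 hj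
    have h1 := strictMonoOn_card_filter_le A hiA hjA hij
    dsimp only at h1
    have h2 := hS3 _ hjS _ hiS h1.ne'
    rw [abs_of_pos (by omega)] at h2
    have h3 := mul_card_filter_sub_le hgap hiA
      ((A.filter (· ≤ j)).card - (A.filter (· ≤ i)).card) j hjA (by omega)
    have h4 : s' * s ≤ s' * ((A.filter (· ≤ j)).card - (A.filter (· ≤ i)).card) :=
      Nat.mul_le_mul_left _ (by omega)
    rw [mul_comm s s']
    omega
  refine ⟨(subsetAt_subset A S).trans hA1, by rw [card_subsetAt (by rwa [hA2]), hS2],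
    fun i hi j hj hij => ?_⟩
  rcases hij.lt_or_gt with h | h
  · rw [abs_sub_comm]
    exact (hlt i hi j hj h).trans (le_abs_self _)
  · exact (hlt j hj i hi h).trans (le_abs_self _)

/-- Color each `s'`-stable `m`-set `A` by a color that `r` disjoint stable `k`-sets inside `A`
share. Then `r'` disjoint sets `A` of one color contain `r * r'` disjoint `k`-sets of that color. -/
theorem ForcesMonochromatic.mul {r s r' s' : ℕ} (hr : 1 ≤ r) (hr' : 1 ≤ r')
    (h : ForcesMonochromatic r s) (h' : ForcesMonochromatic r' s') :
    ForcesMonochromatic (r * r') (s * s') := by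
  intro n k t c hk ht hn hc
  -- The least size to which `h` applies; with it the bound required by `h'` is exactly the one
  -- given for `r * r'`.
  set m := (r - 1) * t + (k - 1) * r + 1 with hm
  have hinner : ∀ A : Finset ℕ, ∃ j, A ∈ almostStableSets n m s' →
      j < t ∧ ∃ f : Fin r → Finset ℕ,
        (∀ i, f i ∈ almostStableSets m k s ∧ c (subsetAt A (f i)) = j) ∧
        Pairwise (Function.onFun Disjoint f) := by
    intro A
    by_cases hA : A ∈ almostStableSets n m s'
    · obtain ⟨j, hj, hf⟩ := h m k t (fun S => c (subsetAt A S)) hk ht le_rfl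
        (fun S hS => hc _ (subsetAt_mem_almostStableSets hA hS))
      exact ⟨j, fun _ => ⟨hj, hf⟩⟩
    · exact ⟨0, fun h => absurd h hA⟩
  choose c' hc' using hinner
  have hbound : (r' - 1) * t + (m - 1) * r' + 1 ≤ n := by
    refine le_trans (le_of_eq ?_) hn
    obtain ⟨a, rfl⟩ := Nat.exists_eq_add_of_le' hr
    obtain ⟨b, rfl⟩ := Nat.exists_eq_add_of_le' hr'
    have : (a + 1) * (b + 1) - 1 = a * b + a + b := by
      rw [Nat.sub_eq_iff_eq_add (Nat.mul_pos (by omega) (by omega))]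
      ring
    rw [hm, this]
    simp only [Nat.add_sub_cancel]
    ring
  obtain ⟨j, hj, F, hF, hFd⟩ := h' n m t c' (by omega) ht hbound (fun A hA => (hc' A hA).1)
  choose f hf hfd using fun i => (hc' (F i) (hF i).1).2
  refine ⟨j, hj, fun x => subsetAt (F (finProdFinEquiv.symm x).2)
    (f (finProdFinEquiv.symm x).2 (finProdFinEquiv.symm x).1),
    fun x => ⟨subsetAt_mem_almostStableSets (hF _).1 (hf _ _).1, ?_⟩, fun x y hxy => ?_⟩
  · rw [(hf _ _).2, (hF _).2]
  · obtain ⟨⟨a, b⟩, rfl⟩ := finProdFinEquiv.surjective x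
    obtain ⟨⟨a', b'⟩, rfl⟩ := finProdFinEquiv.surjective y
    simp only [Function.onFun, Equiv.symm_apply_apply]
    by_cases hb : b = b'
    · subst hb
      exact disjoint_subsetAt _ (hfd b fun h => hxy (by rw [h]))
    · exact Finset.disjoint_of_subset_left (subsetAt_subset _ _)
        (Finset.disjoint_of_subset_right (subsetAt_subset _ _) (hFd hb))

theorem forcesMonochromatic_cardFactors (r : ℕ) (hr : 1 ≤ r) :
    ForcesMonochromatic r (2 ^ ArithmeticFunction.cardFactors r) := by
  induction r using induction_on_primes with
  | zero => omega
  | one => simpa using forcesMonochromatic_one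
  | prime_mul p a hp ih =>
    have ha : a ≠ 0 := by
      rintro rfl
      simp at hr
    have h := (forcesMonochromatic_of_prime hp).mul hp.one_le (by omega) (ih (by omega))
    rwa [ArithmeticFunction.cardFactors_mul hp.ne_zero ha,
      ArithmeticFunction.cardFactors_apply_prime hp, pow_add, pow_one]

/-! ### The two bounds on the chromatic number. -/

/-- With `t` colors, `n < (r - 1) t + (k - 1) r + 1` admits the coloring by blocks of `r - 1`
consecutive minima. -/
theorem exists_isProperColoring {r n k s t : ℕ} (hr : 2 ≤ r) (hk : 1 ≤ k) (ht : 1 ≤ t)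
    (hn : n ≤ (r - 1) * t + (k - 1) * r) :
    ∃ c : (almostStableKneser r n k s).vertexSet → Fin t,
      (almostStableKneser r n k s).IsProperColoring c := by
  have hne : ∀ S ∈ almostStableSets n k s, S.Nonempty := fun S hS =>
    Finset.card_pos.1 (by rw [hS.2.1]; omega)
  refine ⟨fun S => ⟨min ((S.1.min' (hne S.1 S.2) - 1) / (r - 1)) (t - 1), by omega⟩, ?_⟩
  rintro e ⟨heV, hecard, hedisj⟩
  by_contra! hmono
  have hfin : e.Finite := Set.finite_of_encard_eq_coe hecard
  set E : Finset (Finset ℕ) := hfin.toFinset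
  have hEcard : E.card = r := by
    have := hfin.encard_eq_coe_toFinset_card
    rw [hecard] at this
    exact_mod_cast this.symm
  have hEV : ∀ S ∈ E, S ∈ almostStableSets n k s := fun S hS => heV (hfin.mem_toFinset.1 hS)
  have hdisj : ∀ S ∈ E, ∀ T ∈ E, S ≠ T → Disjoint S T := fun S hS T hT =>
    hedisj S (hfin.mem_toFinset.1 hS) T (hfin.mem_toFinset.1 hT)
  obtain ⟨S₀, hS₀⟩ : E.Nonempty := Finset.card_pos.1 (by omega)
  set q := min ((S₀.min' (hne S₀ (hEV S₀ hS₀)) - 1) / (r - 1)) (t - 1) with hq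
  have hcol : ∀ S (hS : S ∈ E),
      min ((S.min' (hne S (hEV S hS)) - 1) / (r - 1)) (t - 1) = q := by
    intro S hS
    have := hmono ⟨S, hEV S hS⟩ ⟨S₀, hEV S₀ hS₀⟩ (hfin.mem_toFinset.1 hS)
      (hfin.mem_toFinset.1 hS₀)
    exact congrArg Fin.val this
  have hmin1 : ∀ S (hS : S ∈ E), 1 ≤ S.min' (hne S (hEV S hS)) := fun S hS =>
    (Finset.mem_Icc.1 ((hEV S hS).1 (Finset.min'_mem _ _))).1
  -- Below the last color, `r` distinct minima would lie among `r - 1` integers. In the last color,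
  -- the `r * k` elements would lie in an interval of at most `r * k - 1` integers.
  rcases (Nat.min_le_right _ _ : q ≤ t - 1).lt_or_eq with hlt | heq
  · have hcard : E.attach.card ≤ (Finset.Icc (q * (r - 1) + 1) (q * (r - 1) + (r - 1))).card := by
      refine Finset.card_le_card_of_injOn (fun S => S.1.min' (hne S.1 (hEV S.1 S.2)))
        (fun S _ => ?_) (fun S _ T _ hST => ?_)
      · have h1 := hcol S.1 S.2
        have h2 : (S.1.min' (hne S.1 (hEV S.1 S.2)) - 1) / (r - 1) = q := by omega
        have h3 := hmin1 S.1 S.2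
        have h4 := Nat.div_add_mod (S.1.min' (hne S.1 (hEV S.1 S.2)) - 1) (r - 1)
        have h5 := Nat.mod_lt (S.1.min' (hne S.1 (hEV S.1 S.2)) - 1) (show r - 1 > 0 by omega)
        rw [h2, mul_comm] at h4
        change S.1.min' (hne S.1 (hEV S.1 S.2)) ∈ Finset.Icc _ _
        exact Finset.mem_Icc.2 ⟨by omega, by omega⟩
      · by_contra hne'
        have hST' : S.1 ≠ T.1 := fun h => hne' (Subtype.ext h)
        refine Finset.disjoint_left.1 (hdisj S.1 S.2 T.1 T.2 hST')
          (Finset.min'_mem S.1 (hne S.1 (hEV S.1 S.2))) ?_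
        dsimp only at hST
        rw [hST]
        exact Finset.min'_mem _ _
    rw [Finset.card_attach, hEcard, Nat.card_Icc] at hcard
    omega
  · have hsub : (E.biUnion fun S => S) ⊆ Finset.Icc ((t - 1) * (r - 1) + 1) n := by
      intro x hx
      obtain ⟨S, hS, hxS⟩ := Finset.mem_biUnion.1 hx
      have h1 := hcol S hS
      have h2 : t - 1 ≤ (S.min' (hne S (hEV S hS)) - 1) / (r - 1) := by omega
      have h3 := (Nat.le_div_iff_mul_le (by omega)).1 h2
      have h4 := hmin1 S hS
      have h5 := Finset.min'_le S x hxS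
      exact Finset.mem_Icc.2 ⟨by omega, (Finset.mem_Icc.1 ((hEV S hS).1 hxS)).2⟩
    have hcard := Finset.card_le_card hsub
    rw [Finset.card_biUnion (fun S hS T hT hST => hdisj S hS T hT hST),
      Finset.sum_congr rfl (fun S hS => (hEV S hS).2.1), Finset.sum_const, hEcard, smul_eq_mul,
      Nat.card_Icc] at hcard
    obtain ⟨a, rfl⟩ := Nat.exists_eq_add_of_le' (show 1 ≤ r by omega)
    obtain ⟨b, rfl⟩ := Nat.exists_eq_add_of_le' ht
    obtain ⟨d, rfl⟩ := Nat.exists_eq_add_of_le' hk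
    simp only [Nat.add_sub_cancel] at hcard hn
    have e1 : a * (b + 1) = b * a + a := by ring
    have e2 : (a + 1) * (d + 1) = d * (a + 1) + a + 1 := by ring
    omega

theorem lt_of_isProperColoring {r n k t : ℕ} (hr : 2 ≤ r) (hk : 1 ≤ k) (hn : r * k ≤ n)
    (c : (almostStableKneser r n k (2 ^ ArithmeticFunction.cardFactors r)).vertexSet → Fin t)
    (hc : (almostStableKneser r n k (2 ^ ArithmeticFunction.cardFactors r)).IsProperColoring c) :
    n ≤ (r - 1) * t + (k - 1) * r := by
  by_contra! hlt
  classical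
  -- `ForcesMonochromatic` needs at least one color; for `t = 0`, `r * k ≤ n` is exactly the bound
  -- with one color.
  have hbound : (r - 1) * max t 1 + (k - 1) * r + 1 ≤ n := by
    rcases Nat.eq_zero_or_pos t with rfl | ht
    · obtain ⟨a, rfl⟩ := Nat.exists_eq_add_of_le' (show 1 ≤ r by omega)
      obtain ⟨d, rfl⟩ := Nat.exists_eq_add_of_le' hk
      simp only [Nat.add_sub_cancel, zero_le, sup_of_le_right, mul_one]
      have : (a + 1) * (d + 1) = d * (a + 1) + a + 1 := by ring
      omega
    · rw [max_eq_left ht]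
      exact hlt
  obtain ⟨j, -, f, hf, hfd⟩ := forcesMonochromatic_cardFactors r (by omega) n k (max t 1)
    (fun S => if hS : S ∈ almostStableSets n k (2 ^ ArithmeticFunction.cardFactors r)
      then (c ⟨S, hS⟩ : ℕ) else 0) hk (le_max_right _ _) hbound
    (fun S hS => by
      rw [dif_pos hS]
      exact lt_max_of_lt_left (c ⟨S, hS⟩).2)
  -- Disjoint equal sets would be empty, against `k ≥ 1`; injectivity makes the range an edge with
  -- exactly `r` elements.
  have hinj : Function.Injective f := by
    intro i i' h
    by_contra hne
    have h1 : Disjoint (f i) (f i') := hfd hne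
    rw [h, disjoint_self] at h1
    have h2 := (hf i').1.2.1
    rw [h1] at h2
    rw [Finset.bot_eq_empty, Finset.card_empty] at h2
    omega
  have hedge : Set.range f ∈
      (almostStableKneser r n k (2 ^ ArithmeticFunction.cardFactors r)).edgeSet := by
    refine ⟨?_, ?_, ?_⟩
    · rintro _ ⟨i, rfl⟩
      exact (hf i).1
    · rw [← Set.image_univ, hinj.encard_image, Set.encard_univ]
      simp
    · rintro _ ⟨i, rfl⟩ _ ⟨i', rfl⟩ hne
      exact hfd fun h => hne (by rw [h])
  obtain ⟨x, y, ⟨i, hi⟩, ⟨i', hi'⟩, hxy⟩ := hc _ hedge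
  apply hxy
  have h1 := (hf i).2
  have h2 := (hf i').2
  rw [dif_pos (hf i).1] at h1
  rw [dif_pos (hf i').1] at h2
  have hx : x = ⟨f i, (hf i).1⟩ := Subtype.ext hi.symm
  have hy : y = ⟨f i', (hf i').1⟩ := Subtype.ext hi'.symm
  rw [hx, hy]
  exact Fin.ext (h1.trans h2.symm)

end StableKneser

theorem corollary2 (n k r : ℕ) (hr : 2 ≤ r) (hk : 1 ≤ k) (hn : r * k ≤ n) :
    (almostStableKneser r n k (2 ^ ArithmeticFunction.cardFactors r)).chromaticNumber =
      ((⌈((n : ℚ) - ((k : ℚ) - 1) * (r : ℚ)) / ((r : ℚ) - 1)⌉₊ : ℕ) : ℕ∞) := by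
  have hr' : (0 : ℚ) < (r : ℚ) - 1 := by
    have : (2 : ℚ) ≤ r := by exact_mod_cast hr
    linarith
  have hceil (t : ℕ) : ⌈((n : ℚ) - ((k : ℚ) - 1) * (r : ℚ)) / ((r : ℚ) - 1)⌉₊ ≤ t ↔
      n ≤ (r - 1) * t + (k - 1) * r := by
    rw [Nat.ceil_le, div_le_iff₀ hr', sub_le_iff_le_add, ← Nat.cast_le (α := ℚ)]
    push_cast [Nat.cast_sub hk, Nat.cast_sub (show 1 ≤ r by omega)]
    rw [mul_comm (t : ℚ)]
  rw [Hypergraph.chromaticNumber]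
  refine le_antisymm ?_ (le_iInf₂ fun t ht => ?_)
  · refine iInf₂_le (f := fun (t : ℕ) _ => (t : ℕ∞)) _
      (StableKneser.exists_isProperColoring hr hk ?_ ((hceil _).1 le_rfl))
    -- The ceiling is at least 1: the value 0 would give `n ≤ (k - 1) * r < r * k`.
    by_contra! h
    have h0 := (hceil 0).1 (by omega)
    have h1 : (k - 1) * r + r = r * k := by
      obtain ⟨d, rfl⟩ := Nat.exists_eq_add_of_le' hk
      rw [Nat.add_sub_cancel]
      ring
    omega
  · obtain ⟨c, hc⟩ := ht
    exact_mod_cast (hceil t).2 (StableKneser.lt_of_isProperColoring hr hk hn c hc)
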